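/- Let $\mathcal{C}$ be a skeletally small, idempotent complete triangulated category with suspension functor $\Sigma$. Let $\mathcal{X}\subseteq\mathcal{C}$ be a full subcategory that is closed under isomorphisms, finite direct sums and direct summands, is rigid (that is, $\mathcal{C}(X,\Sigma X')=0$ for all $X,X'\in\mathcal{X}$), and is contravariantly finite (that is, every $A\in\mathcal{C}$ admits a morphism $\xi\colon X\to A$ with $X\in\mathcal{X}$ such that $\mathcal{C}(X',\xi)$ is surjective for every $X'\in\mathcal{X}$). Let $\operatorname{mod}\mathcal{X}$ be the (abelian) category of finitely presented additive functors $\mathcal{X}^{\mathrm{op}}\to\mathsf{Ab}$, where $M$ is finitely presented if there is an exact sequence $\mathcal{X}(-,P)\to\mathcal{X}(-,Q)\to M\to 0$ with $P,Q\in\mathcal{X}$, and let $H_{\mathcal{X}}\colon\mathcal{C}\to\operatorname{mod}\mathcal{X}$ be the functor $C\mapsto\mathcal{C}(-,C)|_{\mathcal{X}}$. Let $K_0(\operatorname{mod}\mathcal{X})$ be the Grothendieck group of $\operatorname{mod}\mathcal{X}$, generated by isomorphism classes $[M]$ with a relation $[L]-[M]+[N]=0$ for each short exact sequence $0\to L\to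 M\to N\to 0$. Let $(\mathcal{C},\mathbb{E}_{\mathcal{X}},\mathfrak{s}_{\mathcal{X}})$ be the relative extriangulated category with $\mathbb{E}_{\mathcal{X}}(C,A)=\{\delta\in\mathcal{C}(C,\Sigma A) : H_{\mathcal{X}}(\delta)=0\}$, whose conflations are the sequences $A\to B\to C$ that are completed to a distinguished triangle $A\to B\to C\xrightarrow{\delta}\Sigma A$ by some $\delta\in\mathbb{E}_{\mathcal{X}}(C,A)$. Its Grothendieck group $K_0(\mathcal{C},\mathbb{E}_{\mathcal{X}},\mathfrak{s}_{\mathcal{X}})$ is the quotient of the split Grothendieck group $K_0^{\mathrm{sp}}(\mathcal{C})$ by the subgroup generated by the elements $[A]-[B]+[C]$ for all these conflations. For $C\in\mathcal{C}$, let $\operatorname{ind}_{\mathcal{X}}(C)$ be the class of $C$ in $K_0(\mathcal{C},\mathbb{E}_{\mathcal{X}},\mathfrak{s}_{\mathcal{X}})$. Then there is a group homomorphism $$\theta_{\mathcal{X}}\colon K_0(\operatorname{mod}\mathcal{X})\to K_0(\mathcal{C},\mathbb{E}_{\mathcal{X}},\mathfrak{s}_{\mathcal{X}})$$ such that $\theta_{\mathcal{X}}([H_{\mathcal{X}}(C)])=\operatorname{ind}_{\mathcal{X}}(C)+\operatorname{ind}_{\mathcal{X}}(\Sigma^{-1}C)$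 for every $C\in\mathcal{C}$, and such that, for every distinguished triangle $A\to B\to C\xrightarrow{\gamma}\Sigma A$ in $\mathcal{C}$, $$\operatorname{ind}_{\mathcal{X}}(A)-\operatorname{ind}_{\mathcal{X}}(B)+\operatorname{ind}_{\mathcal{X}}(C)=\theta_{\mathcal{X}}\big([\operatorname{Im}H_{\mathcal{X}}(\gamma)]\big),$$ where the image is taken in $\operatorname{mod}\mathcal{X}$. -/

import Mathlib

open CategoryTheory CategoryTheory.Limits CategoryTheory.Pretriangulated

universe w v u

namespace TriIndex

noncomputable section

/-! ### Finitely presented functors -/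

section FinitelyPresented

variable (A : Type u) [Category.{v} A] [Preadditive A]

/-- The additive functors `M : Aᵒᵖ ⥤ Ab` for which there is an exact sequence
`A(-, P) ⟶ A(-, Q) ⟶ M ⟶ 0` with `P` and `Q` in `A`. -/
def IsFinPres : ObjectProperty (Aᵒᵖ ⥤ AddCommGrpCat.{v}) := fun M =>
  M.Additive ∧
    ∃ (P Q : A) (f : preadditiveYoneda.obj P ⟶ preadditiveYoneda.obj Q)
      (g : preadditiveYoneda.obj Q ⟶ M) (w : f ≫ g = 0),
      (ShortComplex.mk f g w).Exact ∧ Epi g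

variable {A} in
/-- The morphism `A(-, T) ⟶ M` that corresponds to an element of `M(T)`. -/
def ofElement (M : Aᵒᵖ ⥤ AddCommGrpCat.{v}) [M.Additive] (T : A) (m : M.obj (Opposite.op T)) :
    preadditiveYoneda.obj T ⟶ M where
  app Y := AddCommGrpCat.ofHom
    { toFun := fun y : Y.unop ⟶ T => (M.map y.op).hom m
      map_zero' := congrArg (fun a => a.hom m) (M.map_zero (Opposite.op T) Y)
      map_add' := fun y z =>
        congrArg (fun a => a.hom m)
          (M.map_add (f := Quiver.Hom.op (show Y.unop ⟶ T from y))
            (g := Quiver.Hom.op (show Y.unop ⟶ T from z))) }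
  naturality Y Z k := by
    ext y
    exact congrArg (fun a => a.hom m) (M.map_comp (Quiver.Hom.op y) k)

variable {A} in
lemma isFinPres_preadditiveYoneda (T : A) : IsFinPres A (preadditiveYoneda.obj T) :=
  ⟨inferInstance, T, T, 0, 𝟙 _, zero_comp,
    (ShortComplex.exact_iff_mono _ rfl).2 (inferInstanceAs (Mono (𝟙 _))), inferInstance⟩

/-- The category `mod A` of finitely presented additive functors `Aᵒᵖ ⥤ Ab`. -/
abbrev FinPresMod := (IsFinPres A).FullSubcategory

variable {A} in
/-- Monomorphisms of `mod A` are monomorphisms of functors. -/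
lemma mono_hom_of_mono {M N : FinPresMod A} (f : M ⟶ N) [Mono f] : Mono f.hom := by
  rw [NatTrans.mono_iff_mono_app]
  intro Y
  rw [AddCommGrpCat.mono_iff_injective]
  refine (injective_iff_map_eq_zero (f.hom.app Y).hom).2 fun m hm => ?_
  have := M.property.1
  let I : FinPresMod A := ⟨preadditiveYoneda.obj Y.unop, isFinPres_preadditiveYoneda _⟩
  let a : I ⟶ M := ObjectProperty.homMk (ofElement M.obj Y.unop m)
  have ha : a ≫ f = 0 := by
    ext Z y
    have e := congrArg (fun b => b.hom m) (f.hom.naturality (Quiver.Hom.op y))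
    refine Eq.trans e ?_
    change (N.obj.map (Quiver.Hom.op y)).hom ((f.hom.app Y).hom m) = 0
    rw [hm, map_zero]
  have ha0 : a = 0 := by rw [← cancel_mono f, ha, zero_comp]
  have e := congrArg (fun b => (b.hom.app Y).hom (𝟙 Y.unop)) ha0
  refine Eq.trans ?_ e
  change m = (M.obj.map (𝟙 Y)).hom m
  rw [M.obj.map_id]
  rfl

end FinitelyPresented

/-! ### Grothendieck groups of abelian categories

A short exact sequence `0 ⟶ S.X₁ ⟶ S.X₂ ⟶ S.X₃ ⟶ 0` in an abelian category is a short complex `S`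
with `S.ShortExact`; this notion only needs zero morphisms in order to be written down. -/

section GrothendieckGroup

variable (A : Type u) [Category.{v} A]

/-- The isomorphism classes of objects of a category. -/
abbrev IsoClass := Quotient (isIsomorphicSetoid A)

variable {A} in
/-- The generator of the free abelian group on isomorphism classes given by an object. -/
def freeClass (M : A) : FreeAbelianGroup (IsoClass A) :=
  FreeAbelianGroup.of (Quotient.mk (isIsomorphicSetoid A) M)

/-- The subgroup generated by `[L] - [M] + [N]` for all short exact sequences
`0 ⟶ L ⟶ M ⟶ N ⟶ 0` in `A`. -/
def shortExactRelations [HasZeroMorphisms A] : AddSubgroup (FreeAbelianGroup (IsoClass A)) :=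
  AddSubgroup.closure
    {x | ∃ S : ShortComplex A, S.ShortExact ∧
      x = freeClass S.X₁ - freeClass S.X₂ + freeClass S.X₃}

/-- The Grothendieck group `K₀(A)`. -/
abbrev K0 [HasZeroMorphisms A] : Type u :=
  FreeAbelianGroup (IsoClass A) ⧸ shortExactRelations A

variable {A} in
/-- The class `[M]` of an object `M` in `K₀(A)`. -/
def K0.mk [HasZeroMorphisms A] (M : A) : K0 A :=
  QuotientAddGroup.mk' (shortExactRelations A) (freeClass M)

/-- The subgroup generated by `[M ⊞ N] - [M] - [N]` for all objects `M`, `N` of `A`. -/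
def splitRelations [HasZeroMorphisms A] [HasBinaryBiproducts A] :
    AddSubgroup (FreeAbelianGroup (IsoClass A)) :=
  AddSubgroup.closure
    {x | ∃ M N : A, x = freeClass (M ⊞ N) - freeClass M - freeClass N}

/-- The split Grothendieck group `K₀ˢᵖ(A)` of an additive category. -/
abbrev K0Split [HasZeroMorphisms A] [HasBinaryBiproducts A] : Type u :=
  FreeAbelianGroup (IsoClass A) ⧸ splitRelations A

variable {A} in
/-- The class of an object in the split Grothendieck group. -/
def K0Split.mk [HasZeroMorphisms A] [HasBinaryBiproducts A] (M : A) : K0Split A :=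
  QuotientAddGroup.mk' (splitRelations A) (freeClass M)

end GrothendieckGroup

/-! ### Subcategories -/

section Subcategories

variable {C : Type u} [Category.{v} C]

/-- An additive subcategory: a full subcategory closed under isomorphisms, (finite) direct sums
and direct summands. -/
structure IsAdditiveSubcategory [HasZeroMorphisms C] [HasBinaryBiproducts C]
    (X : ObjectProperty C) : Prop where
  closed_iso : X.IsClosedUnderIsomorphisms
  contains_zero : X.ContainsZero
  closed_sum : ∀ A B : C, X A → X B → X (A ⊞ B)
  closed_summand : ∀ A B : C, X (A ⊞ B) → X A

/-- `ξ : T ⟶ A` is a right `X`-approximation of `A`. -/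
def IsRightApprox (X : ObjectProperty C) {T A : C} (ξ : T ⟶ A) : Prop :=
  X T ∧ ∀ T' : C, X T' → Function.Surjective (fun g : T' ⟶ T => g ≫ ξ)

/-- Every object has a right `X`-approximation. -/
def IsContravariantlyFinite (X : ObjectProperty C) : Prop :=
  ∀ A : C, ∃ (T : C) (ξ : T ⟶ A), IsRightApprox X ξ

/-- All morphisms `T ⟶ ΣT'` with `T`, `T'` in `X` vanish. -/
def IsRigid [HasZeroMorphisms C] [HasShift C ℤ] (X : ObjectProperty C) : Prop :=
  ∀ T T' : C, X T → X T' → ∀ f : T ⟶ T'⟦(1 : ℤ)⟧, f = 0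

end Subcategories

/-! ### The relative extriangulated structure and its Grothendieck group -/

section Relative

variable {C : Type u} [Category.{v} C] [Preadditive C]

/-- The functor `A ↦ C(-, A)|_X`, with values in all functors `Xᵒᵖ ⥤ Ab`. -/
def restrictedYoneda (X : ObjectProperty C) :
    C ⥤ (X.FullSubcategoryᵒᵖ ⥤ AddCommGrpCat.{v}) :=
  preadditiveYoneda ⋙ (Functor.whiskeringLeft _ _ _).obj X.ι.op

lemma restrictedYoneda_map_apply (X : ObjectProperty C) {A B : C} (f : A ⟶ B)
    (T : X.FullSubcategoryᵒᵖ) (x : T.unop.obj ⟶ A) :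
    (((restrictedYoneda X).map f).app T).hom x = x ≫ f := rfl

lemma restrictedYoneda_map_eq_zero_iff (X : ObjectProperty C) {A B : C} (f : A ⟶ B) :
    (restrictedYoneda X).map f = 0 ↔ ∀ (T : C), X T → ∀ ξ : T ⟶ A, ξ ≫ f = 0 := by
  constructor
  · intro h T hT ξ
    have h1 := congrArg (fun a => (a.app (Opposite.op (⟨T, hT⟩ : X.FullSubcategory))).hom ξ) h
    exact h1
  · intro h
    ext T x
    exact h T.unop.obj T.unop.property x

instance additive_restrictedYoneda_obj (X : ObjectProperty C) (A : C) :
    ((restrictedYoneda X).obj A).Additive where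
  map_add {Y Z f g} := by
    ext y
    exact Preadditive.add_comp _ _ _ f.unop.hom g.unop.hom y

lemma epi_ofElement {X : ObjectProperty C} (T : X.FullSubcategory) {A : C} (ξ : T.obj ⟶ A)
    (hξ : ∀ T' : C, X T' → Function.Surjective (fun g : T' ⟶ T.obj => g ≫ ξ)) :
    Epi (ofElement ((restrictedYoneda X).obj A) T ξ) := by
  rw [NatTrans.epi_iff_epi_app]
  intro Y
  rw [AddCommGrpCat.epi_iff_surjective]
  intro x
  obtain ⟨g, hg⟩ := hξ _ Y.unop.property x
  exact ⟨(ObjectProperty.homMk g : Y.unop ⟶ T), hg⟩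

variable [HasZeroObject C] [HasShift C ℤ] [∀ n : ℤ, (shiftFunctor C n).Additive]
  [Pretriangulated C]

/-- The subgroup `𝔼_X(D, A)` of `𝔼(D, A) = C(D, ΣA)` that consists of the extensions `δ` with
`C(-, δ)|_X = 0`. -/
def relExt (X : ObjectProperty C) (D A : C) : AddSubgroup (D ⟶ A⟦(1 : ℤ)⟧) where
  carrier := {δ | (restrictedYoneda X).map δ = 0}
  zero_mem' := by
    rw [Set.mem_ofPred_eq, restrictedYoneda_map_eq_zero_iff]
    intro T _ ξ
    exact comp_zero
  add_mem' := by
    intro a b ha hb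
    rw [Set.mem_ofPred_eq, restrictedYoneda_map_eq_zero_iff] at *
    intro T hT ξ
    rw [Preadditive.comp_add, ha T hT ξ, hb T hT ξ, add_zero]
  neg_mem' := by
    intro a ha
    rw [Set.mem_ofPred_eq, restrictedYoneda_map_eq_zero_iff] at *
    intro T hT ξ
    rw [Preadditive.comp_neg, ha T hT ξ, neg_zero]

/-- `A ⟶ B ⟶ D` is a conflation of the relative extriangulated category `(C, 𝔼_X, 𝔰_X)`: it is
completed to a distinguished triangle `A ⟶ B ⟶ D ⟶ ΣA` by some `δ` in `𝔼_X(D, A)`. -/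
def IsRelConflation (X : ObjectProperty C) {A B D : C} (f : A ⟶ B) (g : B ⟶ D) : Prop :=
  ∃ δ ∈ relExt X D A, Triangle.mk f g δ ∈ distTriang C

/-- The subgroup of the split Grothendieck group generated by `[A] - [B] + [D]` for all
conflations `A ⟶ B ⟶ D` of `(C, 𝔼_X, 𝔰_X)`. -/
def relRelations (X : ObjectProperty C) : AddSubgroup (K0Split C) :=
  AddSubgroup.closure
    {x | ∃ (A B D : C) (f : A ⟶ B) (g : B ⟶ D), IsRelConflation X f g ∧
      x = K0Split.mk A - K0Split.mk B + K0Split.mk D}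

/-- The Grothendieck group `K₀(C, 𝔼_X, 𝔰_X)`. -/
abbrev RelK0 (X : ObjectProperty C) : Type u := K0Split C ⧸ relRelations X

/-- The index of an object with respect to `X`: its class in `K₀(C, 𝔼_X, 𝔰_X)`. -/
def ind (X : ObjectProperty C) (A : C) : RelK0 X :=
  QuotientAddGroup.mk' (relRelations X) (K0Split.mk A)

/-! ### The functor `H_X : C ⥤ mod X` -/

/-- If `C(-, φ)|_X : X(-, T) ⟶ C(-, D)|_X`, with `T` in `X`, factors as an epimorphism onto `M`
followed by a monomorphism, then `M` is finitely presented. -/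
lemma isFinPres_of_factorisation {X : ObjectProperty C} (hX : IsContravariantlyFinite X)
    (T : X.FullSubcategory) {D : C} (φ : T.obj ⟶ D)
    (M : X.FullSubcategoryᵒᵖ ⥤ AddCommGrpCat.{v})
    (p : preadditiveYoneda.obj T ⟶ M) (i : M ⟶ (restrictedYoneda X).obj D) [Epi p] [Mono i]
    (h : ∀ (Y : X.FullSubcategory) (y : Y ⟶ T),
      (i.app (Opposite.op Y)).hom ((p.app (Opposite.op Y)).hom y) = y.hom ≫ φ) :
    IsFinPres X.FullSubcategory M := by
  have hp : ∀ Y : X.FullSubcategory, Function.Surjective (p.app (Opposite.op Y)).hom := fun Y =>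
    (AddCommGrpCat.epi_iff_surjective _).1 ((NatTrans.epi_iff_epi_app p).1 inferInstance _)
  have hi : ∀ Y : X.FullSubcategory, Function.Injective (i.app (Opposite.op Y)).hom := fun Y =>
    (AddCommGrpCat.mono_iff_injective _).1 ((NatTrans.mono_iff_mono_app i).1 inferInstance _)
  refine ⟨⟨?_⟩, ?_⟩
  · intro Y Z f g
    ext m
    obtain ⟨y, rfl⟩ := hp Y.unop m
    have nat : ∀ k : Y ⟶ Z, (M.map k).hom ((p.app Y).hom y) = (p.app Z).hom (k.unop ≫ y) :=
      fun k => (congrArg (fun a => a.hom y) (p.naturality k)).symm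
    change (M.map (f + g)).hom ((p.app Y).hom y) =
      (M.map f).hom ((p.app Y).hom y) + (M.map g).hom ((p.app Y).hom y)
    rw [nat, nat, nat]
    exact (congrArg (p.app Z).hom (Preadditive.add_comp _ _ _ f.unop g.unop y)).trans
      (map_add (p.app Z).hom (f.unop ≫ y) (g.unop ≫ y))
  · obtain ⟨K, κ, δ, hT⟩ := distinguished_cocone_triangle₁ φ
    obtain ⟨T', ξ, hT', hξ⟩ := hX K
    let P : X.FullSubcategory := ⟨T', hT'⟩
    let f : P ⟶ T := ObjectProperty.homMk (ξ ≫ κ)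
    have hκ : κ ≫ φ = 0 := comp_distTriang_mor_zero₁₂ _ hT
    have w : preadditiveYoneda.map f ≫ p = 0 := by
      ext Y y
      apply hi Y.unop
      refine (h Y.unop (y ≫ f)).trans ?_
      refine Eq.trans ?_ (map_zero (i.app Y).hom).symm
      change (y.hom ≫ (ξ ≫ κ)) ≫ φ = 0
      simp [hκ]
    refine ⟨P, T, preadditiveYoneda.map f, p, w, ?_, inferInstance⟩
    rw [ShortComplex.exact_iff_epi_kernel_lift, NatTrans.epi_iff_epi_app]
    intro Y
    rw [AddCommGrpCat.epi_iff_surjective]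
    intro k
    have hιinj : Function.Injective ((kernel.ι p).app Y).hom :=
      (AddCommGrpCat.mono_iff_injective _).1
        ((NatTrans.mono_iff_mono_app (kernel.ι p)).1 inferInstance _)
    let x : Y.unop ⟶ T := ((kernel.ι p).app Y).hom k
    have hx : (p.app Y).hom x = 0 :=
      congrArg (fun a => (a.app Y).hom k) (kernel.condition p)
    have hx' : x.hom ≫ φ = 0 := by
      rw [← h Y.unop x]
      exact (congrArg (i.app Y).hom hx).trans (map_zero (i.app Y).hom)
    obtain ⟨z, hz⟩ := Triangle.coyoneda_exact₂ _ hT x.hom hx'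
    obtain ⟨t, ht⟩ := hξ _ Y.unop.property z
    let t' : Y.unop ⟶ P := ObjectProperty.homMk t
    refine ⟨t', hιinj ?_⟩
    have e := congrArg (fun a => (a.app Y).hom t') (kernel.lift_ι p (preadditiveYoneda.map f) w)
    refine Eq.trans e ?_
    change t' ≫ f = x
    ext
    change t ≫ ξ ≫ κ = x.hom
    rw [hz, ← ht]
    exact (Category.assoc t ξ κ).symm

lemma isFinPres_restrictedYoneda {X : ObjectProperty C} (hX : IsContravariantlyFinite X) (A : C) :
    IsFinPres X.FullSubcategory ((restrictedYoneda X).obj A) := by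
  obtain ⟨T, ξ, hT, hξ⟩ := hX A
  let p : preadditiveYoneda.obj (⟨T, hT⟩ : X.FullSubcategory) ⟶ (restrictedYoneda X).obj A :=
    ofElement ((restrictedYoneda X).obj A) ⟨T, hT⟩ ξ
  have : Epi p := epi_ofElement ⟨T, hT⟩ ξ hξ
  exact isFinPres_of_factorisation hX ⟨T, hT⟩ ξ _ p (𝟙 _) (fun _ _ => rfl)

/-- The functor `H_X : C ⥤ mod X`, `A ↦ C(-, A)|_X`. -/
def H (X : ObjectProperty C) (hX : IsContravariantlyFinite X) :
    C ⥤ FinPresMod X.FullSubcategory :=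
  (IsFinPres X.FullSubcategory).lift (restrictedYoneda X) (isFinPres_restrictedYoneda hX)

lemma isFinPres_image {X : ObjectProperty C} (hX : IsContravariantlyFinite X) {A B : C}
    (γ : A ⟶ B) : IsFinPres X.FullSubcategory (image ((restrictedYoneda X).map γ)) := by
  obtain ⟨T, ξ, hT, hξ⟩ := hX A
  let p : preadditiveYoneda.obj (⟨T, hT⟩ : X.FullSubcategory) ⟶ (restrictedYoneda X).obj A :=
    ofElement ((restrictedYoneda X).obj A) ⟨T, hT⟩ ξ
  have : Epi p := epi_ofElement ⟨T, hT⟩ ξ hξ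
  refine isFinPres_of_factorisation hX ⟨T, hT⟩ (ξ ≫ γ) _
    (p ≫ factorThruImage ((restrictedYoneda X).map γ)) (image.ι _) (fun Y y => ?_)
  have e := congrArg (fun a => (a.app (Opposite.op Y)).hom ((p.app (Opposite.op Y)).hom y))
    (image.fac ((restrictedYoneda X).map γ))
  refine Eq.trans e ?_
  exact Category.assoc y.hom ξ γ

/-- The morphisms in the image of `H_X` have an image in `mod X`. -/
instance hasImage_H (X : ObjectProperty C) (hX : IsContravariantlyFinite X) {A B : C}
    (γ : A ⟶ B) : HasImage ((H X hX).map γ) := by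
  let φ := (restrictedYoneda X).map γ
  let I : FinPresMod X.FullSubcategory := ⟨image φ, isFinPres_image hX γ⟩
  let m : I ⟶ (H X hX).obj B := ObjectProperty.homMk (image.ι φ)
  let e : (H X hX).obj A ⟶ I := ObjectProperty.homMk (factorThruImage φ)
  have : Mono m := (IsFinPres X.FullSubcategory).ι.mono_of_mono_map
    (show Mono (image.ι φ) from inferInstance)
  let F : MonoFactorisation ((H X hX).map γ) :=
    { I := I
      m := m
      e := e
      fac := by
        ext1
        exact image.fac φ }
  let G (F' : MonoFactorisation ((H X hX).map γ)) : MonoFactorisation φ :=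
    { I := F'.I.obj
      m := F'.m.hom
      m_mono := mono_hom_of_mono F'.m
      e := F'.e.hom
      fac := congrArg (fun a => a.hom) F'.fac }
  exact ⟨⟨{ F := F
            isImage :=
              { lift := fun F' => ObjectProperty.homMk (image.lift (G F'))
                lift_fac := fun F' => by
                  ext1
                  exact image.lift_fac (G F') } }⟩⟩

end Relative

end

end TriIndex

open scoped ZeroObject

namespace TriIndex

/-! ### Indices, desuspension, and which triangles give relations -/

section Index

variable {C : Type u} [Category.{v} C] [Preadditive C] [HasZeroObject C] [HasShift C ℤ]
  [∀ n : ℤ, (shiftFunctor C n).Additive] [Pretriangulated C] {X : ObjectProperty C}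

/-! For a triangle `D ⟶ E ⟶ F ⟶ D⟦1⟧` starting with `γ`, let x(γ) = ind D + ind E⟦-1⟧ - ind F⟦-1⟧.
After rotation this is the left side of the triangle formula. The point is that x(γ) depends only on
the functor Im H(γ), so θ can be defined by [Im H(γ)] ↦ x(γ); the case γ = 𝟙 gives the formula for
[H(D)].

Independence (`IsImageIndex.unique`): by the octahedral axiom, x(γ) is unchanged when γ is
precomposed with a map that H makes surjective, or postcomposed with one that H makes injective,
because the comparison triangles are conflations after desuspension. Two presentations of a functor
can thus be moved to a common source, where both maps have the same kernel under H. Dividing out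
that kernel by a cone, both factor through one map followed, thanks to rigidity, by maps that H
makes injective.

Additivity (`IsImageIndex.sub_add_eq_zero`): rigidity realizes the epimorphism of a short exact
sequence as H(c) with `c : Z ⟶ Z'`. The triangle `W ⟶ Z ⟶ Z'` is then a conflation, the kernel is Im
H(W ⟶ Z), and the alternating sum of the three values is the relation of this conflation. -/

lemma ind_eq_of_iso {A B : C} (e : A ≅ B) : ind X A = ind X B :=
  congrArg (fun a : IsoClass C => QuotientAddGroup.mk' (relRelations X)
    (QuotientAddGroup.mk' (splitRelations C) (FreeAbelianGroup.of a)))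
    (Quotient.sound (s := isIsomorphicSetoid C) ⟨e⟩)

lemma ind_sub_ind_add_ind {A B D : C} {f : A ⟶ B} {g : B ⟶ D} {δ : D ⟶ A⟦(1 : ℤ)⟧}
    (hT : Triangle.mk f g δ ∈ distTriang C) (h : ∀ T : C, X T → ∀ y : T ⟶ D, y ≫ δ = 0) :
    ind X A - ind X B + ind X D = 0 := by
  have hmem : K0Split.mk A - K0Split.mk B + K0Split.mk D ∈ relRelations X :=
    AddSubgroup.subset_closure
      ⟨A, B, D, f, g, ⟨δ, (restrictedYoneda_map_eq_zero_iff X δ).2 h, hT⟩, rfl⟩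
  have := (QuotientAddGroup.eq_zero_iff _).2 hmem
  simpa [ind] using this

variable (X) in
/-- The index of the desuspension of an object. -/
noncomputable def indShift (E : C) : RelK0 X := ind X (E⟦(-1 : ℤ)⟧)

lemma indShift_shift (A : C) : indShift X (A⟦(1 : ℤ)⟧) = ind X A :=
  ind_eq_of_iso ((shiftFunctorCompIsoId C (1 : ℤ) (-1) (by norm_num)).app A)

lemma ind_eq_zero_of_isZero {A : C} (hA : IsZero A) : ind X A = 0 := by
  have h := ind_sub_ind_add_ind (X := X) (contractible_distinguished A)
    (fun _ _ _ => by simp)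
  rw [ind_eq_of_iso ((isZero_zero C).iso hA)] at h
  simpa using h

lemma indShift_eq_zero_of_isZero {A : C} (hA : IsZero A) : indShift X A = 0 :=
  ind_eq_zero_of_isZero ((shiftFunctor C (-1 : ℤ)).map_isZero hA)

/-- Desuspending the triangle turns the vanishing of `δ` on maps from ΣX into the conflation
condition. -/
lemma indShift_sub_indShift_add_indShift {A B D : C} {f : A ⟶ B} {g : B ⟶ D}
    {δ : D ⟶ A⟦(1 : ℤ)⟧} (hT : Triangle.mk f g δ ∈ distTriang C)
    (h : ∀ T : C, X T → ∀ y : T⟦(1 : ℤ)⟧ ⟶ D, y ≫ δ = 0) :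
    indShift X A - indShift X B + indShift X D = 0 := by
  refine ind_sub_ind_add_ind (Triangle.shift_distinguished _ hT (-1)) fun T hT y => ?_
  have hy : y ≫ δ⟦(-1 : ℤ)⟧' = 0 := by
    let e := shiftFunctorCompIsoId C (1 : ℤ) (-1) (by norm_num)
    obtain ⟨z, hz⟩ := (shiftFunctor C (-1 : ℤ)).map_surjective (e.hom.app T ≫ y)
    have h1 := h T hT z
    rw [← cancel_epi (e.hom.app T), ← Category.assoc, ← hz, ← Functor.map_comp, h1,
      Functor.map_zero, comp_zero]
  -- The third map of the shifted triangle is `δ⟦-1⟧'` followed by a commutation isomorphism of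
  -- shifts, up to sign.
  refine (Linear.comp_units_smul _ _ _).trans ?_
  refine (congrArg ((-1 : ℤ).negOnePow • ·) ?_).trans (smul_zero _)
  exact (Category.assoc _ _ _).symm.trans ((congrArg (· ≫ _) hy).trans zero_comp)

/-- The inverse rotation `Y⟦-1⟧ ⟶ A ⟶ B` has connecting map `g`, up to isomorphism. -/
lemma indShift_sub_ind_add_ind {A B Y : C} {f : A ⟶ B} {g : B ⟶ Y} {δ : Y ⟶ A⟦(1 : ℤ)⟧}
    (hT : Triangle.mk f g δ ∈ distTriang C) (h : ∀ T : C, X T → ∀ y : T ⟶ B, y ≫ g = 0) :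
    indShift X Y - ind X A + ind X B = 0 := by
  refine ind_sub_ind_add_ind (inv_rot_of_distTriang _ hT) fun T hT y => ?_
  exact (Category.assoc _ _ _).symm.trans ((congrArg (· ≫ _) (h T hT y)).trans zero_comp)

lemma comp_eq_zero_of_lift {A B Y : C} {f : A ⟶ B} {g : B ⟶ Y} {δ : Y ⟶ A⟦(1 : ℤ)⟧}
    (hT : Triangle.mk f g δ ∈ distTriang C)
    (hf : ∀ T : C, X T → ∀ y : T ⟶ B, ∃ z : T ⟶ A, z ≫ f = y)
    (T : C) (hX : X T) (y : T ⟶ B) : y ≫ g = 0 := by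
  obtain ⟨z, rfl⟩ := hf T hX y
  have : f ≫ g = 0 := comp_distTriang_mor_zero₁₂ _ hT
  simp [this]

/-! ### Invariance of the alternating sum -/

/-- Composing a map with a map that is surjective on morphisms from `X` does not change the
alternating sum of the indices. -/
lemma ind_sub_indShift_precomp [IsTriangulated C] {D D' E F F' : C} {ξ : D' ⟶ D} {γ : D ⟶ E}
    {π : E ⟶ F} {δ : F ⟶ D⟦(1 : ℤ)⟧} (h : Triangle.mk γ π δ ∈ distTriang C)
    {π' : E ⟶ F'} {δ' : F' ⟶ D'⟦(1 : ℤ)⟧} (h' : Triangle.mk (ξ ≫ γ) π' δ' ∈ distTriang C)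
    (hξ : ∀ T : C, X T → ∀ y : T ⟶ D, ∃ z : T ⟶ D', z ≫ ξ = y) :
    ind X D - indShift X F = ind X D' - indShift X F' := by
  obtain ⟨Y, v, w, hY⟩ := distinguished_cocone_triangle ξ
  have hv := comp_eq_zero_of_lift hY hξ
  have h1 := indShift_sub_ind_add_ind hY hv
  -- The cones form a triangle `Y ⟶ F' ⟶ F` with connecting map `δ ≫ v⟦1⟧'`, which vanishes on maps
  -- from ΣX because `v` vanishes on maps from X.
  have o := Triangulated.someOctahedron rfl hY h h'
  have h2 := indShift_sub_indShift_add_indShift (X := X) o.mem fun T hT y => by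
    obtain ⟨z, hz⟩ := (shiftFunctor C (1 : ℤ)).map_surjective (y ≫ δ)
    rw [← Category.assoc, ← hz, ← Functor.map_comp, hv T hT z, Functor.map_zero]
  grind

/-- Composing a map with a map that is injective on morphisms from `X` does not change the
alternating sum of the indices. -/
lemma indShift_sub_indShift_postcomp [IsTriangulated C] {D E E' F F' : C} {γ : D ⟶ E}
    {ψ : E ⟶ E'}
    {π : E ⟶ F} {δ : F ⟶ D⟦(1 : ℤ)⟧} (h : Triangle.mk γ π δ ∈ distTriang C)
    {π' : E' ⟶ F'} {δ' : F' ⟶ D⟦(1 : ℤ)⟧} (h' : Triangle.mk (γ ≫ ψ) π' δ' ∈ distTriang C)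
    (hψ : ∀ T : C, X T → ∀ y : T ⟶ E, y ≫ ψ = 0 → y = 0) :
    indShift X E - indShift X F = indShift X E' - indShift X F' := by
  obtain ⟨G, v, w, hG⟩ := distinguished_cocone_triangle ψ
  have hw : ∀ T : C, X T → ∀ y : T⟦(1 : ℤ)⟧ ⟶ G, y ≫ w = 0 := fun T hT y => by
    obtain ⟨z, hz⟩ := (shiftFunctor C (1 : ℤ)).map_surjective (y ≫ w)
    have h0 : w ≫ ψ⟦(1 : ℤ)⟧' = 0 := comp_distTriang_mor_zero₃₁ _ hG
    have h1 : (z ≫ ψ)⟦(1 : ℤ)⟧' = 0 := by rw [Functor.map_comp, hz, Category.assoc, h0, comp_zero]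
    rw [← hz, hψ T hT z ((shiftFunctor C (1 : ℤ)).map_injective (h1.trans (by simp))),
      Functor.map_zero]
  have h1 := indShift_sub_indShift_add_indShift hG hw
  -- The triangle `F ⟶ F' ⟶ G` has connecting map `w ≫ π⟦1⟧'`, so it inherits the vanishing of `w`.
  have o := Triangulated.someOctahedron rfl h hG h'
  have h2 := indShift_sub_indShift_add_indShift (X := X) o.mem fun T hT y => by
    rw [← Category.assoc, hw T hT y, zero_comp]
  grind

/-- If `ζ` is a cone of a map from an object of `X` that hits all maps from `X` annihilated by `γ`,
then `γ` factors through `ζ` by a map that is injective on morphisms from `X`. -/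
lemma exists_factor_of_kernel (hrigid : IsRigid X) {P D Z E : C} (hP : X P) {f : P ⟶ D}
    {ζ : D ⟶ Z} {w : Z ⟶ P⟦(1 : ℤ)⟧} (hZ : Triangle.mk f ζ w ∈ distTriang C) {γ : D ⟶ E}
    (hf : f ≫ γ = 0) (hγ : ∀ T : C, X T → ∀ y : T ⟶ D, y ≫ γ = 0 → ∃ z, z ≫ f = y) :
    ∃ ψ : Z ⟶ E, ζ ≫ ψ = γ ∧ ∀ T : C, X T → ∀ y : T ⟶ Z, y ≫ ψ = 0 → y = 0 := by
  obtain ⟨ψ, rfl⟩ := Triangle.yoneda_exact₂ _ hZ γ hf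
  refine ⟨ψ, rfl, fun T hT y hy => ?_⟩
  -- By rigidity `y` lifts along `ζ`; the lift is killed by `γ`, hence factors through `f`.
  obtain ⟨d, rfl⟩ := Triangle.coyoneda_exact₃ _ hZ y (hrigid T P hT hP _)
  obtain ⟨z, rfl⟩ := hγ T hT d ((Category.assoc _ _ _).symm.trans hy)
  have h0 : f ≫ ζ = 0 := comp_distTriang_mor_zero₁₂ _ hZ
  exact (Category.assoc _ _ _).trans ((congrArg (z ≫ ·) h0).trans comp_zero)

/-- The maps from `X` annihilated by `γ` are those that factor through some map from an object
of `X`. -/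
lemma exists_kernel_approx (hcf : IsContravariantlyFinite X) {D E : C} (γ : D ⟶ E) :
    ∃ (P : C) (f : P ⟶ D), X P ∧ f ≫ γ = 0 ∧
      ∀ T : C, X T → ∀ y : T ⟶ D, y ≫ γ = 0 → ∃ z, z ≫ f = y := by
  -- The cocone is a weak kernel of `γ`, and it is then approximated from X.
  obtain ⟨B, b, β, hB⟩ := distinguished_cocone_triangle₁ γ
  obtain ⟨P, ρ, hP, hρ⟩ := hcf B
  have h0 : b ≫ γ = 0 := comp_distTriang_mor_zero₁₂ _ hB
  refine ⟨P, ρ ≫ b, hP, by rw [Category.assoc, h0, comp_zero], fun T hT y hy => ?_⟩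
  obtain ⟨x, rfl⟩ := Triangle.coyoneda_exact₂ _ hB y hy
  obtain ⟨z, rfl⟩ := hρ T hT x
  exact ⟨z, (Category.assoc _ _ _).symm⟩

/-- The alternating sum of the indices in a triangle `D ⟶ E ⟶ F ⟶ D⟦1⟧` only depends on which
maps from `X` to `D` are annihilated by `D ⟶ E`. -/
lemma ind_add_indShift_sub_indShift_eq [IsTriangulated C] (hcf : IsContravariantlyFinite X)
    (hrigid : IsRigid X) {D : C} {E F : C} {γ : D ⟶ E}
    {π : E ⟶ F} {δ : F ⟶ D⟦(1 : ℤ)⟧} (h : Triangle.mk γ π δ ∈ distTriang C)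
    {E' F' : C} {γ' : D ⟶ E'}
    {π' : E' ⟶ F'} {δ' : F' ⟶ D⟦(1 : ℤ)⟧} (h' : Triangle.mk γ' π' δ' ∈ distTriang C)
    (hγ : ∀ T : C, X T → ∀ y : T ⟶ D, y ≫ γ = 0 ↔ y ≫ γ' = 0) :
    indShift X E - indShift X F = indShift X E' - indShift X F' := by
  obtain ⟨P, f, hP, hf, hk⟩ := exists_kernel_approx hcf γ
  obtain ⟨Z, ζ, w, hZ⟩ := distinguished_cocone_triangle f
  obtain ⟨ψ, rfl, hψ⟩ := exists_factor_of_kernel hrigid hP hZ hf hk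
  obtain ⟨ψ', rfl, hψ'⟩ := exists_factor_of_kernel hrigid hP hZ ((hγ P hP f).1 hf)
    fun T hT y hy => hk T hT y ((hγ T hT y).2 hy)
  obtain ⟨F₀, π₀, δ₀, h₀⟩ := distinguished_cocone_triangle ζ
  rw [← indShift_sub_indShift_postcomp h₀ h hψ, ← indShift_sub_indShift_postcomp h₀ h' hψ']

end Index

/-! ### Functors as images, and uniqueness of their index -/

lemma iso_app_bijective {A : Type u} [Category.{v} A] {M N : Aᵒᵖ ⥤ AddCommGrpCat.{v}}
    (a : M ≅ N) (Y : A) : Function.Bijective (a.hom.app (Opposite.op Y)).hom :=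
  ⟨(AddCommGrpCat.mono_iff_injective _).1 inferInstance,
    (AddCommGrpCat.epi_iff_surjective _).1 inferInstance⟩

section Image

variable {C : Type u} [Category.{v} C] [Preadditive C] {X : ObjectProperty C}

/-- `i` identifies `M` with the image of `C(-, γ)|_X`. -/
def IsImageInclusion {M : X.FullSubcategoryᵒᵖ ⥤ AddCommGrpCat.{v}} {D E : C}
    (i : M ⟶ (restrictedYoneda X).obj E) (γ : D ⟶ E) : Prop :=
  ∀ Y : X.FullSubcategory, Function.Injective (i.app (Opposite.op Y)).hom ∧
    ∀ e : Y.obj ⟶ E, (∃ m, (i.app (Opposite.op Y)).hom m = e) ↔ ∃ y : Y.obj ⟶ D, y ≫ γ = e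

lemma app_map_apply {M : X.FullSubcategoryᵒᵖ ⥤ AddCommGrpCat.{v}} {E : C}
    (i : M ⟶ (restrictedYoneda X).obj E) {Y Z : X.FullSubcategory} (y : Y ⟶ Z)
    (m : M.obj (Opposite.op Z)) :
    (i.app (Opposite.op Y)).hom ((M.map y.op).hom m) =
      (show Y.obj ⟶ E from y.hom ≫ (show Z.obj ⟶ E from (i.app (Opposite.op Z)).hom m)) :=
  congrArg (fun a => a.hom m) (i.naturality y.op)

lemma restrictedYoneda_hom_comp {D E : C}
    (i : (restrictedYoneda X).obj D ⟶ (restrictedYoneda X).obj E) {Y Z : X.FullSubcategory}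
    (y : Y ⟶ Z) (m : Z.obj ⟶ D) :
    (i.app (Opposite.op Y)).hom (show Y.obj ⟶ D from y.hom ≫ m) =
      (show Y.obj ⟶ E from y.hom ≫ (show Z.obj ⟶ E from (i.app (Opposite.op Z)).hom m)) :=
  app_map_apply i y m

lemma app_injective_of_mono {M N : FinPresMod X.FullSubcategory} (f : M ⟶ N) [Mono f]
    (Y : X.FullSubcategory) : Function.Injective (f.hom.app (Opposite.op Y)).hom :=
  (AddCommGrpCat.mono_iff_injective _).1
    ((NatTrans.mono_iff_mono_app f.hom).1 (mono_hom_of_mono f) _)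

variable [HasZeroObject C] [HasShift C ℤ]
  [∀ n : ℤ, (shiftFunctor C n).Additive] [Pretriangulated C]

/-- `M` is the image of `C(-, γ)|_X` for a triangle `D ⟶ E ⟶ F ⟶ D⟦1⟧` starting with `γ`,
and `x` is the alternating sum of the indices of `D`, `E⟦-1⟧` and `F⟦-1⟧`. -/
def IsImageIndex (M : X.FullSubcategoryᵒᵖ ⥤ AddCommGrpCat.{v}) (x : RelK0 X) : Prop :=
  ∃ (D E F : C) (γ : D ⟶ E) (π : E ⟶ F) (δ : F ⟶ D⟦(1 : ℤ)⟧)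
    (i : M ⟶ (restrictedYoneda X).obj E), Triangle.mk γ π δ ∈ distTriang C ∧
    IsImageInclusion i γ ∧ x = ind X D + indShift X E - indShift X F

lemma IsImageIndex.of_iso {M N : X.FullSubcategoryᵒᵖ ⥤ AddCommGrpCat.{v}} {x : RelK0 X}
    (h : IsImageIndex M x) (e : N ≅ M) : IsImageIndex N x := by
  obtain ⟨D, E, F, γ, π, δ, i, hT, hi, rfl⟩ := h
  refine ⟨D, E, F, γ, π, δ, e.hom ≫ i, hT, fun Y => ⟨?_, fun f => ?_⟩, rfl⟩
  · exact (hi Y).1.comp (iso_app_bijective e Y).1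
  · rw [← (hi Y).2 f]
    constructor
    · rintro ⟨m, hm⟩
      exact ⟨_, hm⟩
    · rintro ⟨m, hm⟩
      obtain ⟨n, rfl⟩ := (iso_app_bijective e Y).2 m
      exact ⟨n, hm⟩

lemma isImageIndex_obj (D : C) :
    IsImageIndex ((restrictedYoneda X).obj D) (ind X D + indShift X D) := by
  refine ⟨D, D, 0, 𝟙 D, 0, 0, 𝟙 _, contractible_distinguished D, fun Y => ⟨fun _ _ h => h,
    fun e => ⟨fun _ => ⟨e, Category.comp_id e⟩, fun _ => ⟨e, rfl⟩⟩⟩, ?_⟩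
  rw [indShift_eq_zero_of_isZero (isZero_zero C), sub_zero]

/-- Both presentations are replaced by maps out of `P ⊞ P'`, for approximations `P` of `D` and `P'`
of `D'`, which induce the same transformation to `M`. -/
lemma IsImageIndex.unique [IsTriangulated C] (hcf : IsContravariantlyFinite X)
    (hrigid : IsRigid X) {M : X.FullSubcategoryᵒᵖ ⥤ AddCommGrpCat.{v}} {x x' : RelK0 X}
    (h : IsImageIndex M x) (h' : IsImageIndex M x') : x = x' := by
  obtain ⟨D, E, F, γ, π, δ, i, hT, hi, rfl⟩ := h
  obtain ⟨D', E', F', γ', π', δ', i', hT', hi', rfl⟩ := h'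
  obtain ⟨P, ξ, hP, hξ⟩ := hcf D
  obtain ⟨P', ξ', hP', hξ'⟩ := hcf D'
  obtain ⟨m, hm⟩ := ((hi ⟨P, hP⟩).2 (ξ ≫ γ)).2 ⟨ξ, rfl⟩
  obtain ⟨m', hm'⟩ := ((hi' ⟨P', hP'⟩).2 (ξ' ≫ γ')).2 ⟨ξ', rfl⟩
  -- Each element is also represented in the other presentation: `d` by way of `m'`, and `d'` by way
  -- of `m`.
  obtain ⟨d, hd⟩ := ((hi ⟨P', hP'⟩).2 _).1 ⟨m', rfl⟩
  obtain ⟨d', hd'⟩ := ((hi' ⟨P, hP⟩).2 _).1 ⟨m, rfl⟩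
  -- The right-hand side involves only `M`, `m` and `m'`, so the kernel is the same for both
  -- presentations.
  have key : ∀ {D E : C} {γ : D ⟶ E} {i : M ⟶ (restrictedYoneda X).obj E}
      (hi : IsImageInclusion i γ) {ξ : P ⟶ D} {d : P' ⟶ D}
      (hm : (i.app (Opposite.op ⟨P, hP⟩)).hom m = ξ ≫ γ)
      (hm' : d ≫ γ = (i.app (Opposite.op ⟨P', hP'⟩)).hom m') (Y : X.FullSubcategory)
      (y : Y.obj ⟶ P ⊞ P'), y ≫ biprod.desc ξ d ≫ γ = 0 ↔
        (M.map (Quiver.Hom.op (ObjectProperty.homMk (y ≫ biprod.fst) : Y ⟶ ⟨P, hP⟩))).hom m +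
        (M.map (Quiver.Hom.op (ObjectProperty.homMk (y ≫ biprod.snd) : Y ⟶ ⟨P', hP'⟩))).hom m'
          = 0 := by
    intro D E γ i hi ξ d hm hm' Y y
    rw [← map_eq_zero_iff _ (hi Y).1, map_add, app_map_apply, app_map_apply, hm, ← hm']
    have e : y ≫ biprod.desc ξ d ≫ γ =
        (y ≫ biprod.fst) ≫ ξ ≫ γ + (y ≫ biprod.snd) ≫ d ≫ γ := by
      rw [biprod.desc_eq]
      simp
    rw [e]
    rfl
  obtain ⟨G, ρ, σ, hG⟩ := distinguished_cocone_triangle (biprod.desc ξ d ≫ γ)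
  obtain ⟨G', ρ', σ', hG'⟩ := distinguished_cocone_triangle (biprod.desc d' ξ' ≫ γ')
  have h1 := ind_sub_indShift_precomp hT hG fun T hT y => by
    obtain ⟨z, rfl⟩ := hξ T hT y
    exact ⟨z ≫ biprod.inl, by simp⟩
  have h2 := ind_sub_indShift_precomp hT' hG' fun T hT y => by
    obtain ⟨z, rfl⟩ := hξ' T hT y
    exact ⟨z ≫ biprod.inr, by simp⟩
  have h3 := ind_add_indShift_sub_indShift_eq hcf hrigid hG hG' fun T hT y =>
    (key hi hm hd ⟨T, hT⟩ y).trans (key hi' hd'.symm hm'.symm ⟨T, hT⟩ y).symm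
  grind

/-- Every finitely presented functor is represented by the cone of a map in `X`. -/
lemma exists_iso_restrictedYoneda (hrigid : IsRigid X)
    {M : X.FullSubcategoryᵒᵖ ⥤ AddCommGrpCat.{v}} (hM : IsFinPres X.FullSubcategory M) :
    ∃ (P Q Z : C) (f : P ⟶ Q) (ζ : Q ⟶ Z) (w : Z ⟶ P⟦(1 : ℤ)⟧), X P ∧ X Q ∧
      Triangle.mk f ζ w ∈ distTriang C ∧ Nonempty (M ≅ (restrictedYoneda X).obj Z) := by
  obtain ⟨_, P, Q, f, g, hw, hex, hg⟩ := hM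
  obtain ⟨f, rfl⟩ : ∃ f' : P ⟶ Q, preadditiveYoneda.map f' = f :=
    preadditiveYoneda.map_surjective f
  obtain ⟨Z, ζ, w, hZ⟩ := distinguished_cocone_triangle f.hom
  refine ⟨P.obj, Q.obj, Z, f.hom, ζ, w, P.property, Q.property, hZ, ⟨?_⟩⟩
  -- By rigidity `C(-, Z)|_X` is a cokernel of the map induced by `f`, as `M` is; the comparison `φ`
  -- is therefore invertible.
  have hζ : ∀ T : C, X T → Function.Surjective (fun g : T ⟶ Q.obj => g ≫ ζ) := fun T hT y => by
    obtain ⟨z, hz⟩ := Triangle.coyoneda_exact₃ _ hZ y (hrigid T _ hT P.property _)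
    exact ⟨z, hz.symm⟩
  have h0 : f.hom ≫ ζ = 0 := comp_distTriang_mor_zero₁₂ _ hZ
  let k := ofElement ((restrictedYoneda X).obj Z) Q ζ
  have : Epi k := epi_ofElement Q ζ hζ
  have hk : preadditiveYoneda.map f ≫ k = 0 := by
    ext Y y
    change (y.hom ≫ f.hom) ≫ ζ = 0
    rw [Category.assoc, h0, comp_zero]
  have hfac := hex.g_desc k hk
  set φ := hex.desc k hk
  have : Epi φ := epi_of_epi_fac hfac
  have : Mono φ := by
    rw [NatTrans.mono_iff_mono_app]
    intro Y
    rw [AddCommGrpCat.mono_iff_injective]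
    refine (injective_iff_map_eq_zero (φ.app Y).hom).2 fun m hm => ?_
    obtain ⟨y, rfl⟩ := (AddCommGrpCat.epi_iff_surjective _).1
      ((NatTrans.epi_iff_epi_app g).1 inferInstance Y) m
    have e : (φ.app Y).hom ((g.app Y).hom y) =
        (show Y.unop.obj ⟶ Z from (show Y.unop ⟶ Q from y).hom ≫ ζ) :=
      congrArg (fun a => (a.app Y).hom y) hfac
    obtain ⟨z, hz⟩ := Triangle.coyoneda_exact₂ _ hZ (show Y.unop ⟶ Q from y).hom
      (e.symm.trans hm)
    have hy : y = (show Y.unop ⟶ Q from (ObjectProperty.homMk z : Y.unop ⟶ P) ≫ f) := by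
      refine ObjectProperty.hom_ext _ ?_
      exact hz
    rw [hy]
    exact congrArg (fun a => (a.app Y).hom (ObjectProperty.homMk z : Y.unop ⟶ P)) hw
  have : IsIso φ := isIso_of_mono_of_epi φ
  exact asIso φ

/-- Maps from the functor represented by the cone of a map in `X` are induced by morphisms. -/
lemma exists_map_eq (hrigid : IsRigid X) {P Q Z Z' : C} (hP : X P) (hQ : X Q) {f : P ⟶ Q}
    {ζ : Q ⟶ Z} {w : Z ⟶ P⟦(1 : ℤ)⟧} (hZ : Triangle.mk f ζ w ∈ distTriang C)
    (φ : (restrictedYoneda X).obj Z ⟶ (restrictedYoneda X).obj Z') :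
    ∃ c : Z ⟶ Z', (restrictedYoneda X).map c = φ := by
  have h0 : f ≫ ζ = 0 := comp_distTriang_mor_zero₁₂ _ hZ
  -- By Yoneda `φ` is determined by its value at `ζ`, since maps from X to `Z` lift to `Q`; this
  -- value extends over the cone.
  let h : Q ⟶ Z' := (φ.app (Opposite.op ⟨Q, hQ⟩)).hom ζ
  have hy : ∀ (Y : X.FullSubcategory) (y : Y.obj ⟶ Q),
      (φ.app (Opposite.op Y)).hom (show Y.obj ⟶ Z from y ≫ ζ) = y ≫ h := fun Y y =>
    restrictedYoneda_hom_comp φ (ObjectProperty.homMk y : Y ⟶ ⟨Q, hQ⟩) ζ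
  have hf : f ≫ h = 0 := by
    rw [← hy ⟨P, hP⟩ f, h0]
    exact map_zero (φ.app _).hom
  obtain ⟨c, hc⟩ := Triangle.yoneda_exact₂ _ hZ h hf
  refine ⟨c, ?_⟩
  ext Y y
  obtain ⟨z, rfl⟩ := Triangle.coyoneda_exact₃ _ hZ y (hrigid _ _ Y.unop.property hP _)
  refine Eq.trans ?_ (hy Y.unop z).symm
  rw [hc]
  exact Category.assoc _ _ _

end Image

/-! ### Exactness in mod X and the homomorphism θ -/

section Theta

variable {C : Type u} [Category.{v} C] [Preadditive C] [HasZeroObject C] [HasShift C ℤ]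
  [∀ n : ℤ, (shiftFunctor C n).Additive] [Pretriangulated C] {X : ObjectProperty C}

/-- Morphisms of `mod X` are isomorphic to morphisms in the image of `H_X`. -/
lemma exists_realization (hrigid : IsRigid X) {M N : FinPresMod X.FullSubcategory} (g : M ⟶ N) :
    ∃ (Z Z' : C) (c : Z ⟶ Z') (a : M.obj ≅ (restrictedYoneda X).obj Z)
      (b : N.obj ≅ (restrictedYoneda X).obj Z'),
      g.hom ≫ b.hom = a.hom ≫ (restrictedYoneda X).map c := by
  obtain ⟨P, Q, Z, f, ζ, w, hP, hQ, hZ, ⟨a⟩⟩ := exists_iso_restrictedYoneda hrigid M.property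
  obtain ⟨-, -, Z', -, -, -, -, -, -, ⟨b⟩⟩ := exists_iso_restrictedYoneda hrigid N.property
  obtain ⟨c, hc⟩ := exists_map_eq hrigid hP hQ hZ (a.inv ≫ g.hom ≫ b.hom)
  exact ⟨Z, Z', c, a, b, by rw [hc, a.hom_inv_id_assoc]⟩

/-- Epimorphisms of `mod X` are surjective. -/
lemma app_surjective_of_epi (hcf : IsContravariantlyFinite X) (hrigid : IsRigid X)
    {M N : FinPresMod X.FullSubcategory} (g : M ⟶ N) [Epi g] (Y : X.FullSubcategory) :
    Function.Surjective (g.hom.app (Opposite.op Y)).hom := by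
  obtain ⟨Z, Z', c, a, b, hc⟩ := exists_realization hrigid g
  -- The test object for the epimorphism is H(V): the map `N ⟶ H(V)` is zero, so every element of
  -- `N` comes from `Z`.
  obtain ⟨V, v, w, hV⟩ := distinguished_cocone_triangle c
  have h0 : c ≫ v = 0 := comp_distTriang_mor_zero₁₂ _ hV
  let φ : N ⟶ (H X hcf).obj V := ObjectProperty.homMk (b.hom ≫ (restrictedYoneda X).map v)
  have hφ : g ≫ φ = 0 := by
    ext1
    change g.hom ≫ b.hom ≫ (restrictedYoneda X).map v = 0
    rw [reassoc_of% hc, ← Functor.map_comp, h0]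
    ext T y
    exact comp_zero
  have hφ0 : φ = 0 := by rw [← cancel_epi g, hφ, comp_zero]
  intro n
  have hn : (show Y.obj ⟶ Z' from (b.hom.app (Opposite.op Y)).hom n) ≫ v = 0 :=
    congrArg (fun a => (a.hom.app (Opposite.op Y)).hom n) hφ0
  obtain ⟨y, hy⟩ := Triangle.coyoneda_exact₂ _ hV _ hn
  obtain ⟨m, hm⟩ := (iso_app_bijective a Y).2 y
  refine ⟨m, (iso_app_bijective b Y).1 ?_⟩
  have e := congrArg (fun a => (a.app (Opposite.op Y)).hom m) hc
  refine Eq.trans e (Eq.trans ?_ hy.symm)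
  exact congrArg ((((restrictedYoneda X).map c).app (Opposite.op Y)).hom) hm

/-- Exact sequences in `mod X` are exact sequences of functors. -/
lemma exists_app_eq_of_exact (hcf : IsContravariantlyFinite X) (hrigid : IsRigid X)
    {S : ShortComplex (FinPresMod X.FullSubcategory)} (hS : S.Exact) (Y : X.FullSubcategory)
    (m : S.X₂.obj.obj (Opposite.op Y)) (hm : (S.g.hom.app (Opposite.op Y)).hom m = 0) :
    ∃ l, (S.f.hom.app (Opposite.op Y)).hom l = m := by
  obtain ⟨⟨h, hH⟩⟩ := hS
  have := S.X₂.property.1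
  let I : FinPresMod X.FullSubcategory := ⟨preadditiveYoneda.obj Y, isFinPres_preadditiveYoneda _⟩
  let a : I ⟶ S.X₂ := ObjectProperty.homMk (ofElement S.X₂.obj Y m)
  have ha : a ≫ S.g = 0 := by
    ext Z y
    have e := congrArg (fun b => b.hom m) (S.g.hom.naturality (Quiver.Hom.op y))
    refine Eq.trans e ?_
    change (S.X₃.obj.map (Quiver.Hom.op y)).hom ((S.g.hom.app (Opposite.op Y)).hom m) = 0
    rw [hm, map_zero]
  -- A map killed by `f'` descends to the homology, which is zero.
  have : Epi h.left.f' := by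
    rw [Preadditive.epi_iff_cancel_zero]
    intro T t ht
    rw [← h.left.π_descH t ht, hH.eq_of_src (h.left.descH t ht) 0, comp_zero]
  -- The Yoneda map `a` of `m` lifts to the kernel, onto which `f'` is surjective.
  obtain ⟨l, hl⟩ := app_surjective_of_epi hcf hrigid h.left.f' Y
    (((h.left.liftK a ha).hom.app (Opposite.op Y)).hom (𝟙 Y))
  refine ⟨l, ?_⟩
  have e1 := congrArg (fun b => (b.hom.app (Opposite.op Y)).hom l) h.left.f'_i
  have e2 := congrArg (fun b => (b.hom.app (Opposite.op Y)).hom (𝟙 Y)) (h.left.liftK_i a ha)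
  have e3 : (a.hom.app (Opposite.op Y)).hom (𝟙 Y) = m := by
    change (S.X₂.obj.map (𝟙 (Opposite.op Y))).hom m = m
    rw [S.X₂.obj.map_id]
    rfl
  exact e1.symm.trans ((congrArg (h.left.i.hom.app (Opposite.op Y)).hom hl).trans (e2.trans e3))

lemma IsImageIndex.sub_add_eq_zero [IsTriangulated C] (hcf : IsContravariantlyFinite X)
    (hrigid : IsRigid X) {S : ShortComplex (FinPresMod X.FullSubcategory)} (hS : S.ShortExact)
    {x₁ x₂ x₃ : RelK0 X} (h₁ : IsImageIndex S.X₁.obj x₁) (h₂ : IsImageIndex S.X₂.obj x₂)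
    (h₃ : IsImageIndex S.X₃.obj x₃) : x₁ - x₂ + x₃ = 0 := by
  have := hS.mono_f
  have := hS.epi_g
  obtain ⟨Z, Z', c, a, b, hc⟩ := exists_realization hrigid S.g
  obtain ⟨W, w, δ, hW⟩ := distinguished_cocone_triangle₁ c
  have hc' : ∀ (Y : X.FullSubcategory) (m : S.X₂.obj.obj (Opposite.op Y)),
      (b.hom.app (Opposite.op Y)).hom ((S.g.hom.app (Opposite.op Y)).hom m) =
        (show Y.obj ⟶ Z' from (show Y.obj ⟶ Z from (a.hom.app (Opposite.op Y)).hom m) ≫ c) :=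
    fun Y m => congrArg (fun a => (a.app (Opposite.op Y)).hom m) hc
  have hL : IsImageIndex S.X₁.obj (ind X W + indShift X Z - indShift X Z') := by
    refine ⟨W, Z, Z', w, c, δ, S.f.hom ≫ a.hom, hW, fun Y => ⟨?_, fun e => ⟨?_, ?_⟩⟩, rfl⟩
    · exact (iso_app_bijective a Y).1.comp (app_injective_of_mono S.f Y)
    · rintro ⟨l, rfl⟩
      have h0 : (S.g.hom.app (Opposite.op Y)).hom ((S.f.hom.app (Opposite.op Y)).hom l) = 0 :=
        congrArg (fun b => (b.hom.app (Opposite.op Y)).hom l) S.zero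
      obtain ⟨y, hy⟩ := Triangle.coyoneda_exact₂ _ hW _ ((hc' Y _).symm.trans
        ((congrArg (b.hom.app (Opposite.op Y)).hom h0).trans
          (map_zero (b.hom.app (Opposite.op Y)).hom)))
      exact ⟨y, hy.symm⟩
    · rintro ⟨y, rfl⟩
      obtain ⟨m, hm⟩ := (iso_app_bijective a Y).2 (show Y.obj ⟶ Z from y ≫ w)
      have h0 : w ≫ c = 0 := comp_distTriang_mor_zero₁₂ _ hW
      have hm' := hc' Y m
      rw [hm] at hm'
      obtain ⟨l, hl⟩ := exists_app_eq_of_exact hcf hrigid hS.exact Y m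
        ((iso_app_bijective b Y).1 (hm'.trans (Eq.trans
          ((Category.assoc _ _ _).trans ((congrArg (y ≫ ·) h0).trans comp_zero))
          (map_zero (b.hom.app (Opposite.op Y)).hom).symm)))
      exact ⟨l, (congrArg (a.hom.app (Opposite.op Y)).hom hl).trans hm⟩
  -- Maps from X to `Z'` lift along `c` because `S.g` is an epimorphism, so `δ` kills them.
  have hW' := ind_sub_ind_add_ind (X := X) hW fun T hT y => by
    obtain ⟨n, hn⟩ := (iso_app_bijective b ⟨T, hT⟩).2 y
    obtain ⟨m, rfl⟩ := app_surjective_of_epi hcf hrigid S.g ⟨T, hT⟩ n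
    have h0 : c ≫ δ = 0 := comp_distTriang_mor_zero₂₃ _ hW
    rw [hn.symm.trans (hc' ⟨T, hT⟩ m), Category.assoc, h0, comp_zero]
  rw [h₁.unique hcf hrigid hL, h₂.unique hcf hrigid ((isImageIndex_obj Z).of_iso a),
    h₃.unique hcf hrigid ((isImageIndex_obj Z').of_iso b)]
  grind

lemma exists_isImageIndex (hrigid : IsRigid X) (M : FinPresMod X.FullSubcategory) :
    ∃ x, IsImageIndex M.obj x := by
  obtain ⟨-, -, Z, -, -, -, -, -, -, ⟨a⟩⟩ := exists_iso_restrictedYoneda hrigid M.property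
  exact ⟨_, (isImageIndex_obj Z).of_iso a⟩

/-- The homomorphism `K₀(mod X) ⟶ K₀(C, 𝔼_X, 𝔰_X)` given by the indices of images. -/
lemma exists_theta [IsTriangulated C] (hcf : IsContravariantlyFinite X) (hrigid : IsRigid X) :
    ∃ θ : K0 (FinPresMod X.FullSubcategory) →+ RelK0 X,
      ∀ (M : FinPresMod X.FullSubcategory) (x : RelK0 X), IsImageIndex M.obj x →
        θ (K0.mk M) = x := by
  choose t ht using exists_isImageIndex (X := X) hrigid
  let q : IsoClass (FinPresMod X.FullSubcategory) → RelK0 X := Quotient.lift t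
    fun M N ⟨e⟩ => (ht M).unique hcf hrigid
      ((ht N).of_iso ((IsFinPres X.FullSubcategory).ι.mapIso e))
  have hq : ∀ M, FreeAbelianGroup.lift q (freeClass M) = t M :=
    fun M => FreeAbelianGroup.lift_apply_of _ _
  refine ⟨QuotientAddGroup.lift _ (FreeAbelianGroup.lift q) ?_, fun M x hx => ?_⟩
  · rw [shortExactRelations, AddSubgroup.closure_le]
    rintro _ ⟨S, hS, rfl⟩
    rw [SetLike.mem_coe, AddMonoidHom.mem_ker, map_add, map_sub, hq, hq, hq]
    exact IsImageIndex.sub_add_eq_zero hcf hrigid hS (ht _) (ht _) (ht _)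
  · exact (hq M).trans ((ht M).unique hcf hrigid hx)

/-- The pointwise image is finitely presented, so the universal property puts the image in mod X
inside it; the factorization of H(γ) gives the reverse inclusion. -/
lemma isImageInclusion_image (hcf : IsContravariantlyFinite X) {D E : C} (γ : D ⟶ E) :
    IsImageInclusion (image.ι ((H X hcf).map γ)).hom γ := by
  let φ := (restrictedYoneda X).map γ
  let F : MonoFactorisation ((H X hcf).map γ) :=
    { I := ⟨image φ, isFinPres_image hcf γ⟩
      m := ObjectProperty.homMk (image.ι φ)
      m_mono := (IsFinPres X.FullSubcategory).ι.mono_of_mono_map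
        (show Mono (image.ι φ) from inferInstance)
      e := ObjectProperty.homMk (factorThruImage φ)
      fac := by
        ext1
        exact image.fac φ }
  intro Y
  refine ⟨app_injective_of_mono _ Y, fun e => ⟨?_, ?_⟩⟩
  · rintro ⟨m, rfl⟩
    obtain ⟨y, hy⟩ := (AddCommGrpCat.epi_iff_surjective _).1
      ((NatTrans.epi_iff_epi_app (factorThruImage φ)).1 inferInstance (Opposite.op Y))
      (((image.lift F).hom.app (Opposite.op Y)).hom m)
    refine ⟨y, ?_⟩
    have e1 := congrArg (fun b => (b.app (Opposite.op Y)).hom y) (image.fac φ)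
    have e2 := congrArg (fun b => (b.hom.app (Opposite.op Y)).hom m) (image.lift_fac F)
    exact e1.symm.trans ((congrArg ((image.ι φ).app (Opposite.op Y)).hom hy).trans e2)
  · rintro ⟨y, rfl⟩
    exact ⟨((factorThruImage ((H X hcf).map γ)).hom.app (Opposite.op Y)).hom y,
      congrArg (fun b => (b.hom.app (Opposite.op Y)).hom y) (image.fac ((H X hcf).map γ))⟩

end Theta

end TriIndex


theorem theoremA {C : Type u} [Category.{v} C] [Preadditive C] [HasZeroObject C]
    [HasShift C ℤ] [∀ n : ℤ, (shiftFunctor C n).Additive] [Pretriangulated C] [IsTriangulated C]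
    [EssentiallySmall.{w} C] [IsIdempotentComplete C]
    (X : ObjectProperty C) (hadd : TriIndex.IsAdditiveSubcategory X)
    (hcf : TriIndex.IsContravariantlyFinite X) (hrigid : TriIndex.IsRigid X) :
    ∃ θ : TriIndex.K0 (TriIndex.FinPresMod X.FullSubcategory) →+ TriIndex.RelK0 X,
      (∀ D : C, θ (TriIndex.K0.mk ((TriIndex.H X hcf).obj D)) =
        TriIndex.ind X D + TriIndex.ind X (D⟦(-1 : ℤ)⟧)) ∧
      ∀ (A B D : C) (α : A ⟶ B) (β : B ⟶ D) (γ : D ⟶ A⟦(1 : ℤ)⟧),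
        Triangle.mk α β γ ∈ distTriang C →
          TriIndex.ind X A - TriIndex.ind X B + TriIndex.ind X D =
            θ (TriIndex.K0.mk (image ((TriIndex.H X hcf).map γ))) := by
  obtain ⟨θ, hθ⟩ := TriIndex.exists_theta hcf hrigid
  refine ⟨θ, fun D => hθ _ _ (TriIndex.isImageIndex_obj D), fun A B D α β γ hT => ?_⟩
  -- Rotating twice gives `D ⟶ A⟦1⟧ ⟶ B⟦1⟧`, starting with `γ`; the desuspensions in its index
  -- cancel these shifts.
  rw [hθ _ _ ⟨D, _, _, γ, _, _, _, rot_of_distTriang _ (rot_of_distTriang _ hT),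
    TriIndex.isImageInclusion_image hcf γ, rfl⟩]
  change _ = TriIndex.ind X D + TriIndex.indShift X (A⟦(1 : ℤ)⟧) -
    TriIndex.indShift X (B⟦(1 : ℤ)⟧)
  rw [TriIndex.indShift_shift, TriIndex.indShift_shift]
  abel
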